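/- Let $C\subset\mathbb{R}^m$ be nonempty, compact and convex (for instance a probability simplex); outcomes and forecasts are points of $C$, and $D$ is the diameter of $C$ in the norm $\|\cdot\|_\infty$. A \emph{binning} $\Pi=(w_i)_{i\in[k]}$ over $C$ consists of functions $w_i:\mathbb{R}^m\to\mathbb{R}$ with $w_i(\mathbf p)\in[0,1]$ and $\sum_{i\in[k]}w_i(\mathbf p)=1$ for all $\mathbf p\in C$. In round $t=1,2,\dots$ a (stochastic) forecasting procedure draws $\mathbf p_t\in C$ from a distribution that depends only on $\mathbf h_\tau,\mathbf p_\tau$, $\tau<t$ (so it is parameter-free: it does not know the horizon $T$ or the confidence level $\delta$), and an adversary chooses $\mathbf h_t\in C$, possibly depending on $\mathbf h_\tau,\mathbf p_\tau$, $\tau<t$, but not on $\mathbf p_t$. For $s<t$ put $$n_{[s,t]}(i)=\sum_{\tau=s}^t w_i(\mathbf p_\tau),\qquad \bar{\mathbf p}_{[s,t]}(i)=\sum_{\tau=s}^t\frac{w_i(\mathbf p_\tau)}{n_{[s,t]}(i)}\mathbf p_\tau,\qquad \bar{\mathbf h}_{[s,t]}(i)=\sum_{\tau=s}^t\frac{w_i(\mathbf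 p_\tau)}{n_{[s,t]}(i)}\mathbf h_\tau,$$ $$\mathrm{CalErr}_i(\mathbf h_{s:t},\mathbf p_{s:t})=\frac{n_{[s,t]}(i)}{t-s}\,\bigl\|\bar{\mathbf p}_{[s,t]}(i)-\bar{\mathbf h}_{[s,t]}(i)\bigr\|_\infty ,$$ which is read as $0$ if $n_{[s,t]}(i)=0$. For $\varepsilon\ge 0$, the procedure is \emph{$(\varepsilon,\Pi)$-adaptively calibrated with rate $r_\delta$} if for all $\delta\in(0,1)$, all adversaries and all $T$, with probability at least $1-\delta$, for all $1\le s<t\le T$ and all $i\in[k]$, $$\mathrm{CalErr}_i(\mathbf h_{s:t},\mathbf p_{s:t})\le r_\delta(t-s,\,t)+\varepsilon .$$ There is an absolute constant $c>0$ such that for all $m$, $k$, all $C$ as above and all binnings $\Pi=(w_i)_{i\in[k]}$ over $C$, with $$r_\delta(\ell,t)=c\,D\,\sqrt{\frac{\log(kmt/\delta)}{\ell}} :$$ (1) for every $\varepsilon>0$ there is a forecasting procedure that is $(\varepsilon,\Pi)$-adaptively calibrated with rate $r_\delta$; (2) if every $w_i$ is continuous on $C$, there is a forecasting procedure that is $(0,\Pi)$-adaptively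 calibrated with rate $r_\delta$. -/

import Mathlib

noncomputable section

namespace AdaptiveCalibration

/-- A finite family of weight functions `w i`, `i ∈ [k]`, is a binning over the forecast space `C`
if on `C` the weights lie in `[0,1]` and sum to one. -/
def IsBinning {m k : ℕ} (C : Set (Fin m → ℝ)) (w : Fin k → (Fin m → ℝ) → ℝ) : Prop :=
  (∀ p ∈ C, ∀ i, w i p ∈ Set.Icc (0 : ℝ) 1) ∧ ∀ p ∈ C, ∑ i, w i p = 1

/-- The transcript of the first `t` rounds: the pairs (outcome, forecast), in order. -/
abbrev History {m : ℕ} (C : Set (Fin m → ℝ)) (t : ℕ) : Type := Fin t → C × C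

/-- A (stochastic) forecasting procedure: after any finite history of outcomes and forecasts it
gives the (discrete) distribution of its next forecast. It sees nothing but the history: no horizon,
no confidence level, and not the outcome of the present round. -/
abbrev ForecastingProcedure {m : ℕ} (C : Set (Fin m → ℝ)) : Type :=
  (t : ℕ) → History C t → PMF C

/-- An adaptive adversary: it chooses the next outcome knowing all past outcomes and forecasts (but
not the present forecast). A fixed sequence of outcomes is the case where the history is ignored. -/
abbrev Adversary {m : ℕ} (C : Set (Fin m → ℝ)) : Type :=
  (t : ℕ) → History C t → C

/-- The law of the transcript of the first `T` rounds, when the procedure `σ` meets the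
adversary `adv`. -/
def transcript {m : ℕ} {C : Set (Fin m → ℝ)} (σ : ForecastingProcedure C) (adv : Adversary C) :
    (T : ℕ) → PMF (History C T)
  | 0 => PMF.pure Fin.elim0
  | T + 1 => (transcript σ adv T).bind fun x =>
      (σ T x).map fun p => Fin.snoc (α := fun _ => C × C) x (adv T x, p)

/-- The effective number `n_{[s,t]}(i)` of times that bin `i`, with weight `v`, is activated. -/
def effCount {m T : ℕ} (v : (Fin m → ℝ) → ℝ) (p : Fin T → Fin m → ℝ) (s t : Fin T) : ℝ :=
  ∑ τ ∈ Finset.Icc s t, v (p τ)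

/-- The weighted average over `[s,t]` of a sequence `x` of vectors, round `τ` having weight
`v (p τ) / n_{[s,t]}`. With `x = p` this is the average forecast in the bin, and with `x = h` the
average outcome in the bin. -/
def binAverage {m T : ℕ} (v : (Fin m → ℝ) → ℝ) (p x : Fin T → Fin m → ℝ) (s t : Fin T) :
    Fin m → ℝ :=
  ∑ τ ∈ Finset.Icc s t, (v (p τ) / effCount v p s t) • x τ

/-- The calibration error on the interval `[s,t]` of a bin with weight `v`; the norm of `Fin m → ℝ`
is the sup norm. A bin that is never activated in the interval has error zero. -/
def calErr {m T : ℕ} (v : (Fin m → ℝ) → ℝ) (h p : Fin T → Fin m → ℝ) (s t : Fin T) : ℝ :=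
  effCount v p s t / (((t : ℕ) : ℝ) - ((s : ℕ) : ℝ)) * ‖binAverage v p p s t - binAverage v p h s t‖

/-- `σ` is `ε`-adaptively calibrated to the binning `w` with rate `r`: for every confidence level
`δ`, adversary and horizon `T`, with probability at least `1 - δ`, simultaneously on all intervals
`[s,t]` with `s < t` among the rounds `1, …, T` and for all bins, the calibration error is at
most `r δ (t - s) t + ε`, where `t - s` is the length of the interval and `t` the number of its
last round. An element `τ : Fin T` stands for round number `τ + 1`. -/
def IsAdaptivelyCalibrated {m k : ℕ} {C : Set (Fin m → ℝ)} (σ : ForecastingProcedure C)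
    (w : Fin k → (Fin m → ℝ) → ℝ) (ε : ℝ) (r : ℝ → ℕ → ℕ → ℝ) : Prop :=
  ∀ δ : ℝ, 0 < δ → δ < 1 → ∀ (adv : Adversary C) (T : ℕ),
    ENNReal.ofReal (1 - δ) ≤ (transcript σ adv T).toOuterMeasure
      {x | ∀ s t : Fin T, s < t → ∀ i : Fin k,
        calErr (w i) (fun τ => ((x τ).1 : Fin m → ℝ)) (fun τ => ((x τ).2 : Fin m → ℝ)) s t
          ≤ r δ ((t : ℕ) - (s : ℕ)) ((t : ℕ) + 1) + ε}

/-- The rate `c · D · √(log (k m t / δ) / ℓ)` on intervals of length `ℓ` whose last round is `t`. -/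
def rate (c D : ℝ) (k m : ℕ) (δ : ℝ) (ℓ t : ℕ) : ℝ :=
  c * D * √(Real.log ((k : ℝ) * m * t / δ) / ℓ)

end AdaptiveCalibration

end

open scoped ENNReal

namespace AdaptiveCalibration

/-! The forecaster plays against sleeping experts. An expert is a bin, a coordinate, a sign, a
wake-up round and a learning rate `η` from a dyadic grid. Its gain `g` in a round is the signed,
bin-weighted coordinate of forecast minus outcome, and its wealth is a prior times `exp (∑ (η g - η²
D²))`, summed over the rounds since it woke up.

Since `exp (y - y²) ≤ 1 + y` for `|y| ≤ 1/2`, one round raises the total wealth by at most `u(p) ⬝ᵥ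
(p - h)` plus the priors of newly woken experts, where the field `u` depends on the past only. By
minimax (`exists_convexHull_forecast`) a random forecast makes the mean of this product as small as
desired against every `h`. With summable slacks the total wealth is a supermartingale up to a
summable error, so by Ville's inequality it stays below `2 / δ` with probability at least `1 - δ`.

Then no single expert is rich. For an interval of length `l` and `Λ = log (kmt/δ)`, the expert
waking near its start with `η` of order `√(Λ/l) / D` certifies a gain of at most `16 D √(Λ l)`
(`sum_gain_le`); dividing by `l` gives the rate. The confidence level enters only through the
threshold, and the minimax slack is absorbed by the wealth, so no additive error remains. -/

theorem exp_sub_sq_le_one_add {y : ℝ} (hy : |y| ≤ 1 / 2) : Real.exp (y - y ^ 2) ≤ 1 + y := by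
  obtain ⟨h1, h2⟩ := abs_le.mp hy
  rcases le_total 0 y with h | h
  · have h3 : 1 - (y - y ^ 2) ≤ Real.exp (-(y - y ^ 2)) := by
      have := Real.add_one_le_exp (-(y - y ^ 2)); linarith
    have h4 : 1 ≤ (1 + y) * Real.exp (-(y - y ^ 2)) := by
      -- `(1 + y) (1 - y + y²) = 1 + y³`.
      have h5 : 0 ≤ y ^ 3 := by positivity
      nlinarith [mul_le_mul_of_nonneg_left h3 (by linarith : 0 ≤ 1 + y)]
    rw [Real.exp_neg, ← div_eq_mul_inv, le_div_iff₀ (Real.exp_pos _)] at h4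
    linarith
  · obtain ⟨x, rfl⟩ : ∃ x, y = -x := ⟨-y, by ring⟩
    have hx0 : 0 ≤ x := by linarith
    have hx1 : x ≤ 1 / 2 := by linarith
    have h3 := Real.quadratic_le_exp_of_nonneg (by positivity : 0 ≤ x + x ^ 2)
    have h4 : 1 ≤ (1 + -x) * Real.exp (x + x ^ 2) := by
      refine le_trans ?_ (mul_le_mul_of_nonneg_left h3 (by linarith : 0 ≤ 1 + -x))
      -- With `z = x + x²`, the product `(1 - x) (1 + z + z²/2)` exceeds `1` by exactly half of this
      -- quantity.
      have h5 : 0 ≤ x ^ 2 * (1 - x - x ^ 2 - x ^ 3) := by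
        refine mul_nonneg (sq_nonneg x) ?_
        nlinarith [mul_nonneg hx0 hx0, mul_nonneg hx0 (sub_nonneg.2 hx1),
          mul_nonneg (mul_nonneg hx0 hx0) (sub_nonneg.2 hx1)]
      nlinarith
    have h6 : -x - (-x) ^ 2 = -(x + x ^ 2) := by ring
    rw [h6, Real.exp_neg, inv_le_iff_one_le_mul₀ (Real.exp_pos _)]
    exact h4

/-! ### Minimax by separation of convex sets -/

/-- Minimax: some convex combination of points of `C` nearly solves the variational inequality of an
arbitrary (possibly discontinuous) vector field `u`. -/
theorem exists_convexHull_forecast {m : ℕ} {C : Set (Fin m → ℝ)} (hne : C.Nonempty)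
    (hC : IsCompact C) (hconv : Convex ℝ C) (u : (Fin m → ℝ) → Fin m → ℝ) {ε : ℝ} (hε : 0 < ε) :
    ∃ y ∈ convexHull ℝ ((fun p => (u p, u p ⬝ᵥ p)) '' C), ∀ h ∈ C, y.2 - y.1 ⬝ᵥ h < ε := by
  by_contra! hcon
  set A := convexHull ℝ ((fun p => (u p, u p ⬝ᵥ p)) '' C) with hA
  set B : Set ((Fin m → ℝ) × ℝ) := {y | ∀ h ∈ C, y.2 - y.1 ⬝ᵥ h < ε} with hB
  have hBconv : Convex ℝ B := by
    intro y hy z hz a b ha hb hab h hh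
    have h1 := hy h hh
    have h2 := hz h hh
    simp only [Prod.snd_add, Prod.smul_snd, Prod.fst_add, Prod.smul_fst, add_dotProduct,
      smul_dotProduct, smul_eq_mul]
    have h3 : a * y.2 + b * z.2 - (a * y.1 ⬝ᵥ h + b * z.1 ⬝ᵥ h)
        = a * (y.2 - y.1 ⬝ᵥ h) + b * (z.2 - z.1 ⬝ᵥ h) := by ring
    rw [h3]
    exact convex_Iio ε h1 h2 ha hb hab
  have hBopen : IsOpen B := by
    have : B = {y | ∀ h ∈ C, (fun q : ((Fin m → ℝ) × ℝ) × (Fin m → ℝ) =>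
        q.1.2 - q.1.1 ⬝ᵥ q.2) (y, h) ∈ Set.Iio ε} := rfl
    rw [this, isOpen_iff_mem_nhds]
    intro y hy
    refine hC.eventually_forall_of_forall_eventually (x₀ := y) fun h hh => ?_
    refine ContinuousAt.eventually_mem (f := fun q : ((Fin m → ℝ) × ℝ) × (Fin m → ℝ) =>
        q.1.2 - q.1.1 ⬝ᵥ q.2) ?_ (isOpen_Iio.mem_nhds (hy h hh))
    exact Continuous.continuousAt (by unfold dotProduct; fun_prop)
  have hdisj : Disjoint B A := by
    rw [Set.disjoint_left]
    intro y hy hyA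
    obtain ⟨h, hh, hle⟩ := hcon y hyA
    exact absurd (hy h hh) (not_lt.2 hle)
  obtain ⟨f, s, hfB, hfA⟩ := geometric_hahn_banach_open hBconv hBopen (convex_convexHull ℝ _) hdisj
  set α : Fin m → ℝ := fun j => f (Pi.single j 1, 0) with hα
  set β : ℝ := f (0, 1) with hβ
  have hf : ∀ v z, f (v, z) = v ⬝ᵥ α + z * β := by
    intro v z
    have h1 : ((v, z) : (Fin m → ℝ) × ℝ)
        = (∑ j, v j • ((Pi.single j 1, 0) : (Fin m → ℝ) × ℝ)) + z • ((0, 1) : (Fin m → ℝ) × ℝ) := by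
      ext j
      · simp [Prod.fst_sum, Pi.single_apply]
      · simp [Prod.snd_sum]
    rw [h1, map_add, map_sum]
    simp only [map_smul, smul_eq_mul, dotProduct, hα, hβ]
  have h0B : ((0, 0) : (Fin m → ℝ) × ℝ) ∈ B := by intro h _; simpa using hε
  have hs : 0 < s := by have := hfB _ h0B; simpa [hf] using this
  -- If `β < 0`, the point `(0, s / β)` lies in `B` although `f` takes the value `s` there.
  have hβ0 : 0 ≤ β := by
    by_contra! hneg
    have h1 : ((0, s / β) : (Fin m → ℝ) × ℝ) ∈ B := by
      intro h _
      have : s / β < 0 := div_neg_of_pos_of_neg hs hneg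
      simp; linarith
    have h2 := hfB _ h1
    rw [hf] at h2
    rw [div_mul_cancel₀ _ hneg.ne] at h2
    simp at h2
  -- a direction along which `f` would be unbounded on `B`
  have key : ∀ v : Fin m → ℝ, ∀ M : ℝ, (∀ h ∈ C, M ≤ v ⬝ᵥ h) → v ⬝ᵥ α + M * β ≤ 0 := by
    intro v M hM
    by_contra! hpos
    set q := v ⬝ᵥ α + M * β with hq
    have h1 : (((s / q) • v, (s / q) * M) : (Fin m → ℝ) × ℝ) ∈ B := by
      intro h hh
      have h2 := hM h hh
      have h3 : 0 < s / q := by positivity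
      simp only [smul_dotProduct, smul_eq_mul]
      nlinarith
    have h2 := hfB _ h1
    rw [hf, smul_dotProduct, smul_eq_mul] at h2
    have h3 : s / q * v ⬝ᵥ α + s / q * M * β = s := by
      rw [show s / q * v ⬝ᵥ α + s / q * M * β = s / q * q by rw [hq]; ring]
      field_simp
    linarith
  rcases hβ0.eq_or_lt with hb | hb
  · have hα0 : ∀ v : Fin m → ℝ, v ⬝ᵥ α ≤ 0 := by
      intro v
      obtain ⟨h0, hh0, hmin⟩ := hC.exists_isMinOn hne
        (f := fun h => v ⬝ᵥ h) (by unfold dotProduct; fun_prop)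
      have := key v (v ⬝ᵥ h0) (fun h hh => hmin hh)
      rwa [← hb, mul_zero, add_zero] at this
    obtain ⟨p, hp⟩ := hne
    have h1 := hfA _ (subset_convexHull ℝ _ (Set.mem_image_of_mem _ hp))
    rw [hf, ← hb, mul_zero, add_zero] at h1
    linarith [hα0 (u p)]
  -- `g` is the mean of the adversary's dual mixed strategy. It lies in `C`, and forecasting `g`
  -- itself gives a point of `A` where `f` vanishes, against `0 < s ≤ f`.
  · set g : Fin m → ℝ := (-β⁻¹) • α with hg
    have hgC : g ∈ C := by
      by_contra hnot
      obtain ⟨φ, a, h1, h2⟩ := geometric_hahn_banach_point_closed hconv hC.isClosed hnot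
      set v : Fin m → ℝ := fun j => φ (Pi.single j 1) with hv
      have hφ : ∀ x, φ x = v ⬝ᵥ x := by
        intro x
        conv_lhs => rw [pi_eq_sum_univ' x]
        simp [dotProduct, hv, mul_comm]
      have h3 := key v a (fun h hh => by rw [← hφ]; exact (h2 h hh).le)
      rw [hφ, hg, dotProduct_smul, smul_eq_mul] at h1
      have h4 : (-β⁻¹ * v ⬝ᵥ α) * β = -(v ⬝ᵥ α) := by field_simp
      nlinarith [mul_lt_mul_of_pos_right h1 hb]
    have h1 := hfA _ (subset_convexHull ℝ _ (Set.mem_image_of_mem _ hgC))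
    rw [hf] at h1
    have h2 : u g ⬝ᵥ g * β = - (u g ⬝ᵥ α) := by
      conv_lhs => rw [hg]
      rw [dotProduct_smul, smul_eq_mul, ← hg]; field_simp
    linarith

/-- The weights of the convex combination become probabilities on finitely many forecasts, and
averaging the affine bound leaves `a + ε`. In the application `G` is the total wealth after the
round and `a` collects the terms independent of the forecast. -/
theorem exists_forecast {m : ℕ} {C : Set (Fin m → ℝ)} (hne : C.Nonempty)
    (hC : IsCompact C) (hconv : Convex ℝ C) (u : (Fin m → ℝ) → Fin m → ℝ) {ε : ℝ} (hε : 0 < ε) :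
    ∃ q : PMF C, ∀ h ∈ C, ∀ (G : C → ℝ) (a : ℝ), (∀ p, 0 ≤ G p) →
      (∀ p : C, G p ≤ a + u p ⬝ᵥ ((p : Fin m → ℝ) - h)) →
      ∑' p, q p * ENNReal.ofReal (G p) ≤ ENNReal.ofReal (a + ε) := by
  obtain ⟨y, hy, hyC⟩ := exists_convexHull_forecast hne hC hconv u hε
  rw [mem_convexHull_iff_exists_fintype] at hy
  obtain ⟨ι, _, v, z, hv0, hv1, hz, hsum⟩ := hy
  choose p hpC hpz using hz
  have hq1 : ∑ i, ENNReal.ofReal (v i) = 1 := by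
    rw [← ENNReal.ofReal_sum_of_nonneg fun i _ => hv0 i, hv1, ENNReal.ofReal_one]
  refine ⟨(PMF.ofFintype _ hq1).map fun i => ⟨p i, hpC i⟩, fun h hh G a hG hGa => ?_⟩
  have hmap : ∑' c, ((PMF.ofFintype _ hq1).map fun i => (⟨p i, hpC i⟩ : C)) c
      * ENNReal.ofReal (G c) = ∑ i, ENNReal.ofReal (v i) * ENNReal.ofReal (G ⟨p i, hpC i⟩) := by
    classical
    simp only [PMF.map_apply, PMF.ofFintype_apply, tsum_fintype, Finset.sum_mul]
    rw [Summable.tsum_finsetSum fun _ _ => ENNReal.summable]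
    refine Finset.sum_congr rfl fun i _ => ?_
    rw [tsum_eq_single (⟨p i, hpC i⟩ : C)]
    · simp
    · intro c hc; simp [hc]
  rw [hmap]
  simp only [← ENNReal.ofReal_mul (hv0 _)]
  rw [← ENNReal.ofReal_sum_of_nonneg fun i _ => mul_nonneg (hv0 i) (hG _)]
  refine ENNReal.ofReal_le_ofReal ?_
  have h1 : ∑ i, v i * G ⟨p i, hpC i⟩ ≤ ∑ i, v i * (a + u (p i) ⬝ᵥ (p i - h)) :=
    Finset.sum_le_sum fun i _ => mul_le_mul_of_nonneg_left (hGa ⟨p i, hpC i⟩) (hv0 i)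
  have h2 : ∑ i, v i * (a + u (p i) ⬝ᵥ (p i - h)) = a + (y.2 - y.1 ⬝ᵥ h) := by
    rw [← hsum]
    simp only [← hpz, Prod.fst_sum, Prod.snd_sum, Prod.smul_fst, Prod.smul_snd, smul_eq_mul,
      sum_dotProduct, smul_dotProduct, dotProduct_sub, mul_add, mul_sub, Finset.sum_add_distrib,
      Finset.sum_sub_distrib, ← Finset.sum_mul, hv1, one_mul]
  linarith [hyC h hh]

/-! ### Supermartingale bounds along the transcript -/

/-- A recursive expectation bound along the transcript. -/
theorem tsum_transcript_mul_le {m : ℕ} {C : Set (Fin m → ℝ)} (σ : ForecastingProcedure C)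
    (adv : Adversary C) (V : (T : ℕ) → History C T → ℝ≥0∞) (b : ℕ → ℝ≥0∞)
    (hV : ∀ T x, ∑' p, σ T x p * V (T + 1) (Fin.snoc (α := fun _ => C × C) x (adv T x, p))
      ≤ V T x + b T) (T : ℕ) :
    ∑' x, transcript σ adv T x * V T x ≤ V 0 Fin.elim0 + ∑ t ∈ Finset.range T, b t := by
  classical
  induction T with
  | zero =>
    rw [tsum_eq_single (Fin.elim0 : History C 0)]
    · simp [transcript]
    · intro x hx
      exact absurd (Subsingleton.elim x _) hx
  | succ T ih =>
    have h1 : ∀ x : History C T, ∑' z, ((σ T x).map fun p =>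
        Fin.snoc (α := fun _ => C × C) x (adv T x, p)) z * V (T + 1) z
        = ∑' p, σ T x p * V (T + 1) (Fin.snoc (α := fun _ => C × C) x (adv T x, p)) := by
      intro x
      simp only [PMF.map_apply, ← ENNReal.tsum_mul_right]
      rw [ENNReal.tsum_comm]
      refine tsum_congr fun p => ?_
      rw [tsum_eq_single (Fin.snoc (α := fun _ => C × C) x (adv T x, p))]
      · simp
      · intro z hz; simp [hz]
    calc ∑' z, transcript σ adv (T + 1) z * V (T + 1) z
        = ∑' x, transcript σ adv T x * ∑' z, ((σ T x).map fun p =>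
            Fin.snoc (α := fun _ => C × C) x (adv T x, p)) z * V (T + 1) z := by
          simp only [transcript, PMF.bind_apply, ← ENNReal.tsum_mul_right, ← ENNReal.tsum_mul_left]
          rw [ENNReal.tsum_comm]
          simp only [mul_assoc]
      _ ≤ ∑' x, transcript σ adv T x * (V T x + b T) := by
          refine ENNReal.tsum_le_tsum fun x => ?_
          rw [h1]
          exact mul_le_mul_right (hV T x) _
      _ = ∑' x, transcript σ adv T x * V T x + b T := by
          simp only [mul_add]
          rw [ENNReal.tsum_add, ENNReal.tsum_mul_right, PMF.tsum_coe, one_mul]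
      _ ≤ _ := by
          rw [Finset.sum_range_succ, ← add_assoc]
          gcongr

/-- The maximum of a process over all prefixes of a history. -/
def runningMax {m : ℕ} {C : Set (Fin m → ℝ)} (W : (T : ℕ) → History C T → ℝ≥0∞) :
    (T : ℕ) → History C T → ℝ≥0∞
  | 0, x => W 0 x
  | T + 1, x => max (runningMax W T (Fin.init x)) (W (T + 1) x)

theorem le_runningMax {m : ℕ} {C : Set (Fin m → ℝ)} (W : (T : ℕ) → History C T → ℝ≥0∞)
    {t T : ℕ} (h : t ≤ T) (x : History C T) :
    W t (fun i => x (Fin.castLE h i)) ≤ runningMax W T x := by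
  induction T with
  | zero =>
    obtain rfl : t = 0 := by omega
    exact le_rfl
  | succ T ih =>
    rcases Nat.lt_or_ge T t with h1 | h1
    · obtain rfl : t = T + 1 := by omega
      exact le_max_right _ _
    · exact (ih h1 (Fin.init x)).trans (le_max_left _ _)

/-- Ville's maximal inequality for processes adapted to the transcript. -/
theorem mul_toOuterMeasure_runningMax_le {m : ℕ} {C : Set (Fin m → ℝ)} (σ : ForecastingProcedure C)
    (adv : Adversary C) (W : (T : ℕ) → History C T → ℝ≥0∞) (b : ℕ → ℝ≥0∞)
    (hW : ∀ T x, ∑' p, σ T x p * W (T + 1) (Fin.snoc (α := fun _ => C × C) x (adv T x, p))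
      ≤ W T x + b T) (K : ℝ≥0∞) (T : ℕ) :
    K * (transcript σ adv T).toOuterMeasure {x | K ≤ runningMax W T x}
      ≤ W 0 Fin.elim0 + ∑ t ∈ Finset.range T, b t := by
  classical
  -- The stopped process: it is frozen at `K` as soon as `W` has reached `K`, and so inherits the
  -- one-step bound of `W`.
  set V : (T : ℕ) → History C T → ℝ≥0∞ := fun T x => if K ≤ runningMax W T x then K else W T x
  have hV0 : V 0 Fin.elim0 ≤ W 0 Fin.elim0 := by
    simp only [V, runningMax]; split_ifs with h <;> simp [h]
  have hV : ∀ T x, ∑' p, σ T x p * V (T + 1) (Fin.snoc (α := fun _ => C × C) x (adv T x, p))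
      ≤ V T x + b T := by
    intro T x
    by_cases h : K ≤ runningMax W T x
    · have h1 : ∀ p, V (T + 1) (Fin.snoc (α := fun _ => C × C) x (adv T x, p)) = K := by
        intro p
        simp only [V, runningMax, Fin.init_snoc]
        rw [if_pos (h.trans (le_max_left _ _))]
      simp only [h1]
      rw [ENNReal.tsum_mul_right, PMF.tsum_coe, one_mul]
      simp only [V, if_pos h]
      exact le_self_add
    · refine le_trans (ENNReal.tsum_le_tsum fun p => mul_le_mul_right ?_ _)
        ((hW T x).trans (by simp [V, if_neg h]))
      simp only [V, runningMax, Fin.init_snoc]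
      split_ifs with h1
      · exact (le_max_iff.1 h1).resolve_left h
      · exact le_rfl
  refine le_trans ?_ ((tsum_transcript_mul_le σ adv V b hV T).trans (by gcongr))
  rw [PMF.toOuterMeasure_apply, ← ENNReal.tsum_mul_left]
  refine ENNReal.tsum_le_tsum fun x => ?_
  by_cases h : K ≤ runningMax W T x
  · simp [Set.indicator, V, h, mul_comm]
  · simp [Set.indicator, h]

end AdaptiveCalibration

namespace AdaptiveCalibration

/-! ### Sleeping experts and their wealth -/

/-- The signed gain of the expert `(i, j, b)` in one round, given the pair (outcome, forecast). -/
noncomputable def gain {m k : ℕ} {C : Set (Fin m → ℝ)} (w : Fin k → (Fin m → ℝ) → ℝ) (e : Fin k × Fin m × Bool)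
    (y : C × C) : ℝ :=
  (if e.2.2 then 1 else -1) * (w e.1 y.2 * ((y.2 : Fin m → ℝ) e.2.1 - (y.1 : Fin m → ℝ) e.2.1))

theorem abs_sub_apply_le_diam {m : ℕ} {C : Set (Fin m → ℝ)} (hC : IsCompact C) {p h : Fin m → ℝ}
    (hp : p ∈ C) (hh : h ∈ C) (j : Fin m) : |p j - h j| ≤ Metric.diam C := by
  refine le_trans ?_ (Metric.dist_le_diam_of_mem hC.isBounded hp hh)
  rw [← Real.dist_eq]
  exact dist_le_pi_dist p h j

theorem abs_gain_le_diam {m k : ℕ} {C : Set (Fin m → ℝ)} (hC : IsCompact C)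
    {w : Fin k → (Fin m → ℝ) → ℝ} (hw : IsBinning C w) (e : Fin k × Fin m × Bool) (y : C × C) :
    |gain w e y| ≤ Metric.diam C := by
  have h1 := abs_sub_apply_le_diam hC y.2.2 y.1.2 e.2.1
  have h2 := hw.1 _ y.2.2 e.1
  have h3 : |(if e.2.2 then 1 else -1 : ℝ)| = 1 := by split_ifs <;> simp
  rw [gain, abs_mul, h3, one_mul, abs_mul, abs_of_nonneg h2.1]
  exact (mul_le_of_le_one_left (abs_nonneg _) h2.2).trans h1

/-- The grid of learning rates. -/
noncomputable def learningRate (D : ℝ) (r : ℕ) : ℝ := (1 / 2) ^ r / (2 * D)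

/-- The log-wealth of an expert that wakes up in round `a` and uses the `r`-th learning rate. -/
noncomputable def logWealth {m k : ℕ} {C : Set (Fin m → ℝ)} (w : Fin k → (Fin m → ℝ) → ℝ) (D : ℝ) (a r : ℕ)
    (e : Fin k × Fin m × Bool) {T : ℕ} (x : History C T) : ℝ :=
  ∑ τ : Fin T, if a ≤ (τ : ℕ) then
    learningRate D r * gain w e (x τ) - (learningRate D r) ^ 2 * D ^ 2 else 0

/-- The initial wealth of an expert that wakes up in round `a`. -/
noncomputable def prior (k m a : ℕ) : ℝ := 1 / (2 * k * m * (a + 1) ^ 2 * (a + 2))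

/-- The wealth of all experts that are awake in round `T`. -/
noncomputable def totalWealth {m k : ℕ} {C : Set (Fin m → ℝ)} (w : Fin k → (Fin m → ℝ) → ℝ) (D : ℝ)
    (T : ℕ) (x : History C T) : ℝ :=
  ∑ a ∈ Finset.range (T + 1), ∑ r ∈ Finset.range (a + 1), ∑ e,
    prior k m a * Real.exp (logWealth w D a r e x)

/-- The vector field whose variational inequality the next forecast has to solve. -/
noncomputable def forecastField {m k : ℕ} {C : Set (Fin m → ℝ)} (w : Fin k → (Fin m → ℝ) → ℝ) (D : ℝ)
    (T : ℕ) (x : History C T) (p : Fin m → ℝ) : Fin m → ℝ :=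
  ∑ a ∈ Finset.range (T + 1), ∑ r ∈ Finset.range (a + 1), ∑ e : Fin k × Fin m × Bool,
    (prior k m a * Real.exp (logWealth w D a r e x) * learningRate D r *
      ((if e.2.2 then 1 else -1) * w e.1 p)) • Pi.single e.2.1 1

theorem prior_nonneg (k m a : ℕ) : 0 ≤ prior k m a := by unfold prior; positivity

theorem totalWealth_nonneg {m k : ℕ} {C : Set (Fin m → ℝ)} (w : Fin k → (Fin m → ℝ) → ℝ) (D : ℝ)
    (T : ℕ) (x : History C T) : 0 ≤ totalWealth w D T x :=
  Finset.sum_nonneg fun a _ => Finset.sum_nonneg fun _ _ => Finset.sum_nonneg fun _ _ =>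
    mul_nonneg (prior_nonneg k m a) (Real.exp_pos _).le

theorem logWealth_eq_zero {m k : ℕ} {C : Set (Fin m → ℝ)} (w : Fin k → (Fin m → ℝ) → ℝ) (D : ℝ)
    {a : ℕ} (r : ℕ) (e : Fin k × Fin m × Bool) {T : ℕ} (h : T ≤ a) (x : History C T) :
    logWealth w D a r e x = 0 :=
  Finset.sum_eq_zero fun τ _ => if_neg (by have := τ.2; omega)

theorem logWealth_snoc {m k : ℕ} {C : Set (Fin m → ℝ)} (w : Fin k → (Fin m → ℝ) → ℝ) (D : ℝ)
    {a : ℕ} (r : ℕ) (e : Fin k × Fin m × Bool) {T : ℕ} (h : a ≤ T) (x : History C T) (y : C × C) :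
    logWealth w D a r e (Fin.snoc (α := fun _ => C × C) x y) = logWealth w D a r e x +
      (learningRate D r * gain w e y - (learningRate D r) ^ 2 * D ^ 2) := by
  simp [logWealth, Fin.sum_univ_castSucc, h]

theorem learningRate_nonneg {D : ℝ} (hD : 0 < D) (r : ℕ) : 0 ≤ learningRate D r := by
  unfold learningRate; positivity

theorem exp_mul_sub_sq_le {D η g : ℝ} (hη : 0 ≤ η) (hηD : η * D ≤ 1 / 2) (hg : |g| ≤ D) :
    Real.exp (η * g - η ^ 2 * D ^ 2) ≤ 1 + η * g := by
  have h1 : |η * g| ≤ η * D := by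
    rw [abs_mul, abs_of_nonneg hη]; exact mul_le_mul_of_nonneg_left hg hη
  refine le_trans (Real.exp_le_exp.2 ?_) (exp_sub_sq_le_one_add (h1.trans hηD))
  have h2 : (η * g) ^ 2 ≤ (η * D) ^ 2 := sq_le_sq' (by linarith [(abs_le.1 h1).1]) (abs_le.1 h1).2
  rw [mul_pow η D] at h2
  linarith

theorem learningRate_mul_le {D : ℝ} (hD : 0 < D) (r : ℕ) : learningRate D r * D ≤ 1 / 2 := by
  have h : learningRate D r * D = (1 / 2) ^ r / 2 := by unfold learningRate; field_simp
  rw [h]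
  have : (1 / 2 : ℝ) ^ r ≤ 1 := pow_le_one₀ (by norm_num) (by norm_num)
  linarith

/-- There are `a + 1` learning rates and `2km` triples, so the prior is chosen to leave a
telescoping series in `a`. -/
theorem sum_prior {k m : ℕ} (hk : 0 < k) (hm : 0 < m) (a : ℕ) :
    ∑ _r ∈ Finset.range (a + 1), ∑ _e : Fin k × Fin m × Bool, prior k m a
      = 1 / ((a + 1) * (a + 2)) := by
  have h1 : (0 : ℝ) < k := by exact_mod_cast hk
  have h2 : (0 : ℝ) < m := by exact_mod_cast hm
  simp [prior]
  field_simp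

/-- Each awake expert's wealth is multiplied by at most `1 + η g`. The linear terms add up to the
field paired with `p - h`, and the experts waking in round `T + 1` contribute their priors. -/
theorem totalWealth_snoc_le {m k : ℕ} (hk : 0 < k) (hm : 0 < m) {C : Set (Fin m → ℝ)}
    (hC : IsCompact C) {w : Fin k → (Fin m → ℝ) → ℝ} (hw : IsBinning C w)
    (hD : 0 < Metric.diam C) (T : ℕ) (x : History C T) (y : C × C) :
    totalWealth w (Metric.diam C) (T + 1) (Fin.snoc (α := fun _ => C × C) x y)
      ≤ totalWealth w (Metric.diam C) T x + 1 / (((T : ℝ) + 2) * (T + 3)) +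
        forecastField w (Metric.diam C) T x y.2 ⬝ᵥ ((y.2 : Fin m → ℝ) - y.1) := by
  set D := Metric.diam C
  have hfield : forecastField w D T x y.2 ⬝ᵥ ((y.2 : Fin m → ℝ) - y.1) =
      ∑ a ∈ Finset.range (T + 1), ∑ r ∈ Finset.range (a + 1), ∑ e,
        prior k m a * Real.exp (logWealth w D a r e x) * (learningRate D r * gain w e y) := by
    simp only [forecastField, sum_dotProduct, smul_dotProduct, single_one_dotProduct, smul_eq_mul,
      gain, Pi.sub_apply, mul_assoc]
  have hfresh : ∑ r ∈ Finset.range (T + 1 + 1), ∑ e, prior k m (T + 1) *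
      Real.exp (logWealth w D (T + 1) r e (Fin.snoc (α := fun _ => C × C) x y))
      = 1 / (((T : ℝ) + 2) * (T + 3)) := by
    simp only [logWealth_eq_zero w D _ _ le_rfl, Real.exp_zero, mul_one]
    rw [sum_prior hk hm]
    push_cast
    ring_nf
  rw [totalWealth, Finset.sum_range_succ, hfresh, hfield, totalWealth, add_right_comm]
  simp only [← Finset.sum_add_distrib]
  gcongr with a ha r _ e _
  rw [logWealth_snoc w D r e (by simpa [Nat.lt_succ_iff] using ha), Real.exp_add, ← mul_assoc]
  have h1 := exp_mul_sub_sq_le (learningRate_nonneg hD r) (learningRate_mul_le hD r)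
    (abs_gain_le_diam hC hw e y)
  have h2 := mul_le_mul_of_nonneg_left h1
    (mul_nonneg (prior_nonneg k m a) (Real.exp_pos (logWealth w D a r e x)).le)
  linarith

/-! ### The procedure and its high-probability wealth bound -/

/-- The forecasting procedure keeping the total wealth of all experts small. -/
theorem exists_procedure {m k : ℕ} (hk : 0 < k) (hm : 0 < m) {C : Set (Fin m → ℝ)}
    (hne : C.Nonempty) (hC : IsCompact C) (hconv : Convex ℝ C) {w : Fin k → (Fin m → ℝ) → ℝ}
    (hw : IsBinning C w) (hD : 0 < Metric.diam C) :
    ∃ σ : ForecastingProcedure C, ∀ (adv : Adversary C) (T : ℕ) (x : History C T),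
      ∑' p, σ T x p * ENNReal.ofReal (totalWealth w (Metric.diam C) (T + 1)
          (Fin.snoc (α := fun _ => C × C) x (adv T x, p)))
        ≤ ENNReal.ofReal (totalWealth w (Metric.diam C) T x)
          + ENNReal.ofReal (2 / (((T : ℝ) + 2) * (T + 3))) := by
  -- The minimax slack is taken equal to the fresh prior mass of the round, whence the `2` in the
  -- numerator.
  have hpos : ∀ T : ℕ, 0 < 1 / (((T : ℝ) + 2) * (T + 3)) := fun T => by positivity
  choose σ hσ using fun (T : ℕ) (x : History C T) =>
    exists_forecast hne hC hconv (forecastField w (Metric.diam C) T x) (hpos T)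
  refine ⟨σ, fun adv T x => ?_⟩
  refine (hσ T x (adv T x) (adv T x).2 _ _ (fun p => totalWealth_nonneg _ _ _ _)
    fun p => totalWealth_snoc_le hk hm hC hw hD T x (adv T x, p)).trans ?_
  rw [← ENNReal.ofReal_add (totalWealth_nonneg _ _ _ _) (by positivity)]
  refine ENNReal.ofReal_le_ofReal (le_of_eq ?_)
  ring

theorem sum_range_two_div (T : ℕ) :
    ∑ t ∈ Finset.range T, 2 / (((t : ℝ) + 2) * (t + 3)) = 1 - 2 / (T + 2) := by
  induction T with
  | zero => simp
  | succ T ih =>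
    rw [Finset.sum_range_succ, ih]
    push_cast
    field_simp
    ring

theorem totalWealth_zero {m k : ℕ} (hk : 0 < k) (hm : 0 < m) {C : Set (Fin m → ℝ)}
    (w : Fin k → (Fin m → ℝ) → ℝ) (D : ℝ) (x : History C 0) : totalWealth w D 0 x = 1 / 2 := by
  have h := sum_prior hk hm 0
  simp only [totalWealth, logWealth_eq_zero w D _ _ (Nat.zero_le _), Real.exp_zero, mul_one]
  simpa using h

/-- With high probability the total wealth stays below `2 / δ` at all times. -/
theorem ofReal_le_toOuterMeasure_totalWealth_lt {m k : ℕ} (hk : 0 < k) (hm : 0 < m)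
    {C : Set (Fin m → ℝ)} {w : Fin k → (Fin m → ℝ) → ℝ} {σ : ForecastingProcedure C} {D : ℝ}
    {adv : Adversary C}
    (hσ : ∀ (T : ℕ) (x : History C T), ∑' p, σ T x p * ENNReal.ofReal (totalWealth w D (T + 1)
          (Fin.snoc (α := fun _ => C × C) x (adv T x, p))) ≤ ENNReal.ofReal (totalWealth w D T x)
          + ENNReal.ofReal (2 / (((T : ℝ) + 2) * (T + 3))))
    {δ : ℝ} (hδ : 0 < δ) (T : ℕ) :
    ENNReal.ofReal (1 - δ) ≤ (transcript σ adv T).toOuterMeasure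
      {x | ∀ (t : ℕ) (h : t ≤ T), totalWealth w D t (fun i => x (Fin.castLE h i)) < 2 / δ} := by
  set μ := (transcript σ adv T).toOuterMeasure
  set W : (T : ℕ) → History C T → ℝ≥0∞ := fun T x => ENNReal.ofReal (totalWealth w D T x)
  have hV := mul_toOuterMeasure_runningMax_le σ adv W _ hσ (ENNReal.ofReal (2 / δ)) T
  set bad := {x | ENNReal.ofReal (2 / δ) ≤ runningMax W T x}
  set good := {x : History C T |
    ∀ (t : ℕ) (h : t ≤ T), totalWealth w D t (fun i => x (Fin.castLE h i)) < 2 / δ}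
  have hcover : Set.univ ⊆ bad ∪ good := by
    intro x _
    by_cases hx : x ∈ bad
    · exact Or.inl hx
    · refine Or.inr fun t h => ?_
      have h1 := (le_runningMax W h x).trans_lt (not_le.1 hx)
      exact (ENNReal.ofReal_lt_ofReal_iff (by positivity)).1 h1
  have huniv : μ Set.univ = 1 := by
    rw [PMF.toOuterMeasure_apply_eq_one_iff]
    exact Set.subset_univ _
  have hbad : μ bad ≤ ENNReal.ofReal δ := by
    have h1 : ENNReal.ofReal (2 / δ) * μ bad ≤ ENNReal.ofReal 2 := by
      refine hV.trans ?_
      simp only [W]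
      -- Initial wealth `1/2` plus increments of total at most `1` stays below `2`.
      rw [totalWealth_zero hk hm, ← ENNReal.ofReal_sum_of_nonneg fun i _ => by positivity,
        ← ENNReal.ofReal_add (by norm_num) (Finset.sum_nonneg fun i _ => by positivity),
        sum_range_two_div]
      refine ENNReal.ofReal_le_ofReal ?_
      have : (0 : ℝ) ≤ 2 / (T + 2) := by positivity
      linarith
    have h2 : ENNReal.ofReal 2 = ENNReal.ofReal (2 / δ) * ENNReal.ofReal δ := by
      rw [← ENNReal.ofReal_mul (by positivity), div_mul_cancel₀ _ hδ.ne']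
    rw [h2] at h1
    exact (ENNReal.mul_le_mul_iff_right (by simpa using hδ) ENNReal.ofReal_ne_top).1 h1
  have h1 : 1 ≤ ENNReal.ofReal δ + μ good := by
    rw [← huniv]
    exact (MeasureTheory.measure_mono hcover).trans ((MeasureTheory.measure_union_le _ _).trans (by gcongr))
  rw [ENNReal.ofReal_sub _ hδ.le, ENNReal.ofReal_one]
  exact tsub_le_iff_left.2 h1

/-! ### Tuning the learning rate and regret on intervals -/

theorem exists_learningRate_index {Λ l : ℝ} (hΛ : 1 / 2 ≤ Λ) (hl : Λ ≤ l) :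
    ∃ r : ℕ, (r : ℝ) + 1 ≤ 2 * √(Λ * l) ∧ l * (1 / 2) ^ r ≤ 2 * √(Λ * l) ∧
      Λ * 2 ^ r ≤ √(Λ * l) ∧ ((r : ℝ) + 1) ^ 2 ≤ 2 * l := by
  have hΛ0 : 0 < Λ := by linarith
  have hl0 : 0 < l := by linarith
  set Q := √(Λ * l)
  have hQ0 : 0 < Q := Real.sqrt_pos.2 (by positivity)
  have hQ : Q ^ 2 = Λ * l := Real.sq_sqrt (by positivity)
  have h1 : 1 ≤ Q / Λ := by
    rw [le_div_iff₀ hΛ0, one_mul]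
    exact Real.le_sqrt_of_sq_le (by nlinarith)
  -- `2 ^ r` is `√(l / Λ)` up to a factor `2`, which balances the costs `l η D²` and `Λ / η`.
  obtain ⟨r, hr1, hr2⟩ := exists_nat_pow_near h1 (by norm_num : (1 : ℝ) < 2)
  rw [le_div_iff₀ hΛ0] at hr1
  rw [div_lt_iff₀ hΛ0, pow_succ] at hr2
  have hr3 : (r : ℝ) + 1 ≤ 2 ^ r := by exact_mod_cast Nat.lt_two_pow_self
  have hr4 : ((r : ℝ) + 1) * Λ ≤ Q := (mul_le_mul_of_nonneg_right hr3 hΛ0.le).trans hr1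
  have hr0 : (0 : ℝ) ≤ r := r.cast_nonneg
  refine ⟨r, by nlinarith, ?_, by linarith, ?_⟩
  · have h2 : Λ * l ≤ Λ * (2 * Q * 2 ^ r) := by nlinarith
    have h3 := le_of_mul_le_mul_left h2 hΛ0
    rw [one_div, inv_pow, ← div_eq_mul_inv, div_le_iff₀ (by positivity)]
    exact h3
  · have h2 : Λ * (((r : ℝ) + 1) ^ 2 * Λ) ≤ Λ * l := by
      rw [← hQ]; nlinarith [mul_nonneg (add_nonneg hr0 zero_le_one) hΛ0.le]
    have h3 := le_of_mul_le_mul_left h2 hΛ0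
    nlinarith [sq_nonneg ((r : ℝ) + 1)]

/-- With `q = km/δ ≥ 1`, the argument on the left is at most `8 q N³`, and `8 ≤ N³` because `N ≥ 2`;
this gives the sixth power. -/
theorem log_two_div_prior_le {k m a N : ℕ} (hk : 0 < k) (hm : 0 < m) (haN : a < N) (hN : 2 ≤ N)
    {δ : ℝ} (hδ : 0 < δ) (hδ1 : δ < 1) :
    Real.log (2 / δ / prior k m a) ≤ 6 * Real.log ((k : ℝ) * m * N / δ) := by
  have h1 : (1 : ℝ) ≤ k := by exact_mod_cast hk
  have h2 : (1 : ℝ) ≤ m := by exact_mod_cast hm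
  have h3 : (2 : ℝ) ≤ N := by exact_mod_cast hN
  have h4 : (a : ℝ) + 1 ≤ N := by exact_mod_cast haN
  have ha : (0 : ℝ) ≤ a := a.cast_nonneg
  have hpr : 0 < prior k m a := by unfold prior; positivity
  rw [show (6 : ℝ) = (6 : ℕ) by norm_num, ← Real.log_pow]
  refine Real.log_le_log (by positivity) ?_
  set q : ℝ := k * m / δ
  have hkm : 1 ≤ (k : ℝ) * m := by nlinarith
  have hq : 1 ≤ q := by rw [le_div_iff₀ hδ]; linarith
  have h5 : 2 / δ / prior k m a = 4 * q * ((a + 1) ^ 2 * (a + 2)) := by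
    simp only [prior, q]; field_simp; ring
  have h6 : ((k : ℝ) * m * N / δ) ^ 6 = q ^ 6 * N ^ 6 := by
    rw [← mul_pow]; congr 1; simp only [q]; ring
  rw [h5, h6]
  have h7 : ((a : ℝ) + 1) ^ 2 * (a + 2) ≤ N ^ 2 * (2 * N) := by
    gcongr
    linarith
  have h8 : q ≤ q ^ 6 := le_self_pow₀ hq (by norm_num)
  have h9 : (8 : ℝ) ≤ N ^ 3 := by
    have := pow_le_pow_left₀ (by norm_num) h3 3; norm_num at this; exact this
  calc 4 * q * (((a : ℝ) + 1) ^ 2 * (a + 2)) ≤ 4 * q * (N ^ 2 * (2 * N)) := by gcongr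
    _ = q * (8 * N ^ 3) := by ring
    _ ≤ q ^ 6 * (N ^ 3 * N ^ 3) := by gcongr
    _ = q ^ 6 * N ^ 6 := by ring

theorem logWealth_castLE {m k : ℕ} {C : Set (Fin m → ℝ)} (w : Fin k → (Fin m → ℝ) → ℝ) (D : ℝ)
    (a r : ℕ) (e : Fin k × Fin m × Bool) {T : ℕ} (x : History C T) (t : Fin T) :
    logWealth w D a r e (fun i : Fin (t + 1) => x (Fin.castLE t.2 i)) =
      ∑ τ ∈ (Finset.Iic t).filter fun τ : Fin T => a ≤ (τ : ℕ),
        (learningRate D r * gain w e (x τ) - (learningRate D r) ^ 2 * D ^ 2) := by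
  have h : Finset.Iic t = (Finset.univ : Finset (Fin (t + 1))).map (Fin.castLEEmb t.2) := by
    ext τ
    simp only [Finset.mem_Iic, Finset.mem_map, Finset.mem_univ, true_and]
    constructor
    · intro hτ
      exact ⟨⟨τ, Nat.lt_succ_of_le hτ⟩, Fin.ext rfl⟩
    · rintro ⟨i, rfl⟩
      exact Nat.lt_succ_iff.1 i.2
  rw [Finset.sum_filter, h, Finset.sum_map]
  rfl

theorem card_filter_fin_le {T : ℕ} (P : Fin T → Prop) [DecidablePred P] {u v n : ℕ}
    (hP : ∀ τ, P τ → u ≤ τ ∧ (τ : ℕ) < v) (hn : v ≤ u + n) :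
    (Finset.univ.filter P).card ≤ n := by
  have h : (Finset.univ.filter P).card ≤ (Finset.Ico u v).card := by
    refine Finset.card_le_card_of_injOn (fun τ => (τ : ℕ)) (fun τ hτ => ?_)
      (fun _ _ _ _ h => Fin.ext h)
    simpa using hP τ (by simpa using hτ)
  rw [Nat.card_Ico] at h
  omega

/-- Bounded wealth forces small regret on every interval. -/
theorem sum_gain_le {m k : ℕ} (hk : 0 < k) (hm : 0 < m) {C : Set (Fin m → ℝ)}
    (hC : IsCompact C) {w : Fin k → (Fin m → ℝ) → ℝ} (hw : IsBinning C w)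
    (hD : 0 < Metric.diam C) {δ : ℝ} (hδ : 0 < δ) (hδ1 : δ < 1) {T : ℕ} {x : History C T}
    {s t : Fin T} (hst : s < t)
    (hx : totalWealth w (Metric.diam C) (t + 1) (fun i => x (Fin.castLE t.2 i)) < 2 / δ)
    (e : Fin k × Fin m × Bool) :
    ∑ τ ∈ Finset.Icc s t, gain w e (x τ) ≤ 16 * Metric.diam C *
      √(Real.log ((k : ℝ) * m * ((t : ℕ) + 1 : ℕ) / δ) * ((t : ℕ) - (s : ℕ) : ℕ)) := by
  set D := Metric.diam C
  set Λ := Real.log ((k : ℝ) * m * ((t : ℕ) + 1 : ℕ) / δ) with hΛdef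
  have hst' : (s : ℕ) < t := hst
  set l : ℕ := (t : ℕ) - (s : ℕ) with hl
  have hl1 : (1 : ℝ) ≤ l := by exact_mod_cast (by omega : 1 ≤ l)
  have hΛ : 1 / 2 ≤ Λ := by
    have h1 : (1 : ℝ) ≤ k := by exact_mod_cast hk
    have h2 : (1 : ℝ) ≤ m := by exact_mod_cast hm
    have h3 : (2 : ℝ) ≤ ((t : ℕ) + 1 : ℕ) := by exact_mod_cast (by omega : 2 ≤ (t : ℕ) + 1)
    have h4 : Real.log 2 ≤ Λ := by
      refine Real.log_le_log (by norm_num) ?_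
      rw [le_div_iff₀ hδ]
      have h5 : 1 ≤ (k : ℝ) * m := by nlinarith
      nlinarith
    linarith [Real.log_two_gt_d9]
  have hgain : ∀ τ, gain w e (x τ) ≤ D := fun τ =>
    (le_abs_self _).trans (abs_gain_le_diam hC hw e _)
  set Q := √(Λ * l)
  have hQ0 : 0 ≤ Q := Real.sqrt_nonneg _
  -- On short intervals, `l ≤ Λ`, the trivial bound `(l + 1) D ≤ 2 D Q` suffices.
  rcases le_total (l : ℝ) Λ with hcase | hcase
  · have h1 : ∑ τ ∈ Finset.Icc s t, gain w e (x τ) ≤ (Finset.Icc s t).card • D :=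
      Finset.sum_le_card_nsmul _ _ _ fun τ _ => hgain τ
    have h2 : (Finset.Icc s t).card = l + 1 := by rw [Fin.card_Icc]; omega
    have h3 : (l : ℝ) ≤ Q := Real.le_sqrt_of_sq_le (by nlinarith)
    rw [h2, nsmul_eq_mul] at h1
    push_cast at h1
    nlinarith
  · obtain ⟨r, hr1, hr2, hr3, hr4⟩ := exists_learningRate_index hΛ hcase
    have hrl : r ≤ l := by
      have : (r : ℝ) ≤ l := by nlinarith
      exact_mod_cast this
    -- Rate `r` is available only to experts waking in round `r` or later. Waiting for it costs at
    -- most `r` rounds, hence at most `2 D Q`.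
    set a := max (s : ℕ) r with ha
    have hat : a ≤ t := by omega
    set η := learningRate D r with hη
    have hη0 : 0 < η := by rw [hη]; unfold learningRate; positivity
    have hwealth : logWealth w D a r e (fun i : Fin (t + 1) => x (Fin.castLE t.2 i))
        ≤ 6 * Λ := by
      have hpr : 0 < prior k m a := by
        have h1 : (0 : ℝ) < k := by exact_mod_cast hk
        have h2 : (0 : ℝ) < m := by exact_mod_cast hm
        unfold prior; positivity
      refine le_trans ?_ (log_two_div_prior_le (a := a) hk hm (Nat.lt_succ_of_le hat)
        (by omega) hδ hδ1)
      rw [Real.le_log_iff_exp_le (by positivity), le_div_iff₀ hpr, mul_comm]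
      refine le_trans ?_ hx.le
      have hnn : ∀ a' r' e', 0 ≤ prior k m a' * Real.exp
          (logWealth w D a' r' e' fun i : Fin (t + 1) => x (Fin.castLE t.2 i)) :=
        fun a' r' e' => mul_nonneg (prior_nonneg k m a') (Real.exp_pos _).le
      refine le_trans ?_ (Finset.single_le_sum (fun a' _ => Finset.sum_nonneg fun r' _ =>
        Finset.sum_nonneg fun e' _ => hnn a' r' e') (Finset.mem_range.2 (by omega : a < t + 1 + 1)))
      refine le_trans ?_ (Finset.single_le_sum (fun r' _ =>
        Finset.sum_nonneg fun e' _ => hnn a r' e') (Finset.mem_range.2 (by omega : r < a + 1)))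
      exact Finset.single_le_sum (fun e' _ => hnn a r e') (Finset.mem_univ e)
    rw [logWealth_castLE, Finset.sum_sub_distrib, ← Finset.mul_sum, Finset.sum_const,
      nsmul_eq_mul] at hwealth
    set F := (Finset.Iic t).filter fun τ : Fin T => a ≤ (τ : ℕ) with hF
    have hFcard : (F.card : ℝ) ≤ 2 * l := by
      have h1 : F.card ≤ l + 1 := by
        have : F = Finset.univ.filter fun τ => τ ≤ t ∧ a ≤ (τ : ℕ) := by
          ext τ; simp [hF]
        rw [this]
        refine card_filter_fin_le _ (u := a) (v := t + 1) (fun τ hτ => ⟨hτ.2, ?_⟩) (by omega)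
        exact Nat.lt_succ_of_le hτ.1
      have h2 : (F.card : ℝ) ≤ l + 1 := by exact_mod_cast h1
      linarith
    have hsplit : ∑ τ ∈ Finset.Icc s t, gain w e (x τ) = ∑ τ ∈ F, gain w e (x τ) +
        ∑ τ ∈ (Finset.Icc s t).filter fun τ : Fin T => ¬ a ≤ (τ : ℕ), gain w e (x τ) := by
      rw [← Finset.sum_filter_add_sum_filter_not (Finset.Icc s t) fun τ : Fin T => a ≤ (τ : ℕ)]
      congr 2
      ext τ
      simp only [hF, Finset.mem_filter, Finset.mem_Icc, Finset.mem_Iic]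
      refine ⟨fun h => ⟨h.1.2, h.2⟩, fun h => ⟨⟨?_, h.1⟩, h.2⟩⟩
      exact Fin.le_def.2 (by omega)
    have hlost : ∑ τ ∈ (Finset.Icc s t).filter fun τ : Fin T => ¬ a ≤ (τ : ℕ), gain w e (x τ)
        ≤ r * D := by
      refine (Finset.sum_le_card_nsmul _ _ _ fun τ _ => hgain τ).trans ?_
      rw [nsmul_eq_mul]
      have h1 : ((Finset.Icc s t).filter fun τ : Fin T => ¬ a ≤ (τ : ℕ)).card ≤ r := by
        have : ((Finset.Icc s t).filter fun τ : Fin T => ¬ a ≤ (τ : ℕ))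
            = Finset.univ.filter fun τ => (s ≤ τ ∧ τ ≤ t) ∧ ¬ a ≤ (τ : ℕ) := by
          ext τ; simp
        rw [this]
        exact card_filter_fin_le _ (u := s) (v := a)
          (fun τ hτ => ⟨hτ.1.1, not_le.1 hτ.2⟩) (by omega)
      gcongr
    -- Dividing the wealth bound by `η`: the quadratic penalty costs `2 D Q`, and `6 Λ / η = 12 D Λ
    -- 2 ^ r` costs `12 D Q`.
    have hmain : ∑ τ ∈ F, gain w e (x τ) ≤ 2 * D * Q + 12 * D * Q := by
      have h1 : η * (2 * D * 2 ^ r) = 1 := by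
        rw [hη]; unfold learningRate
        rw [one_div, inv_pow]
        field_simp
      have h2 : (F.card : ℝ) * (η ^ 2 * D ^ 2) ≤ η * (2 * D * Q) := by
        have h3 : η * D = (1 / 2) ^ r / 2 := by rw [hη]; unfold learningRate; field_simp
        have h4 : (F.card : ℝ) * (η * D) ≤ 2 * Q := by
          rw [h3]
          have : (0 : ℝ) ≤ (1 / 2) ^ r / 2 := by positivity
          nlinarith
        have h5 : (F.card : ℝ) * (η ^ 2 * D ^ 2) = η * D * (F.card * (η * D)) := by ring
        rw [h5]
        nlinarith [mul_pos hη0 hD]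
      have h6 : 6 * Λ ≤ η * (12 * D * Q) := by
        have h7 : 6 * Λ = η * (12 * D * (Λ * 2 ^ r)) := by
          calc 6 * Λ = 6 * Λ * (η * (2 * D * 2 ^ r)) := by rw [h1, mul_one]
            _ = _ := by ring
        rw [h7]
        gcongr
      refine le_of_mul_le_mul_left ?_ hη0
      linarith
    rw [hsplit]
    nlinarith

/-! ### From regret to calibration error -/

theorem calErr_le {m T : ℕ} {v : (Fin m → ℝ) → ℝ} {h p : Fin T → Fin m → ℝ} {s t : Fin T}
    (hst : s < t) {B : ℝ} (hB0 : 0 ≤ B)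
    (hB : ∀ j, |∑ τ ∈ Finset.Icc s t, v (p τ) * (p τ j - h τ j)| ≤ B)
    (hv : 0 ≤ effCount v p s t) :
    calErr v h p s t ≤ B / (((t : ℕ) : ℝ) - ((s : ℕ) : ℝ)) := by
  have hl : (0 : ℝ) < ((t : ℕ) : ℝ) - ((s : ℕ) : ℝ) := sub_pos.2 (by exact_mod_cast hst)
  rw [calErr, div_mul_eq_mul_div]
  refine div_le_div_of_nonneg_right ?_ hl.le
  rcases hv.eq_or_lt with h0 | h0
  · rw [← h0, zero_mul]; exact hB0
  · rw [← le_div_iff₀' h0, pi_norm_le_iff_of_nonneg (by positivity)]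
    intro j
    rw [le_div_iff₀' h0, Real.norm_eq_abs]
    nth_rewrite 1 [← abs_of_pos h0]
    rw [← abs_mul]
    refine le_of_eq_of_le (congrArg abs ?_) (hB j)
    simp only [binAverage, Pi.sub_apply, Finset.sum_apply, Pi.smul_apply, smul_eq_mul,
      ← Finset.sum_sub_distrib, Finset.mul_sum]
    refine Finset.sum_congr rfl fun τ _ => ?_
    field_simp

/-- If `C` has positive diameter, some procedure is adaptively calibrated without additive error. -/
theorem exists_isAdaptivelyCalibrated_of_diam_pos {m k : ℕ} (hk : 0 < k) (hm : 0 < m)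
    {C : Set (Fin m → ℝ)} (hne : C.Nonempty) (hC : IsCompact C) (hconv : Convex ℝ C)
    {w : Fin k → (Fin m → ℝ) → ℝ} (hw : IsBinning C w) (hD : 0 < Metric.diam C) :
    ∃ σ : ForecastingProcedure C, IsAdaptivelyCalibrated σ w 0 (rate 16 (Metric.diam C) k m) := by
  obtain ⟨σ, hσ⟩ := exists_procedure hk hm hne hC hconv hw hD
  refine ⟨σ, fun δ hδ hδ1 adv T => ?_⟩
  refine (ofReal_le_toOuterMeasure_totalWealth_lt hk hm (hσ adv) hδ T).trans
    (MeasureTheory.measure_mono fun x hx s t hst i => ?_)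
  have hst' : (s : ℕ) < t := hst
  have hreg := sum_gain_le hk hm hC hw hD hδ hδ1 hst (hx (t + 1) t.2)
  set D := Metric.diam C
  set Λ := Real.log ((k : ℝ) * m * ((t : ℕ) + 1 : ℕ) / δ) with hΛ
  have hlcast : (((t : ℕ) - (s : ℕ) : ℕ) : ℝ) = ((t : ℕ) : ℝ) - ((s : ℕ) : ℝ) :=
    Nat.cast_sub hst'.le
  have hl : (0 : ℝ) < (((t : ℕ) - (s : ℕ) : ℕ) : ℝ) := by exact_mod_cast (by omega)
  refine (calErr_le hst (B := 16 * D * √(Λ * ((t : ℕ) - (s : ℕ) : ℕ))) (by positivity)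
    (fun j => ?_) (Finset.sum_nonneg fun τ _ => (hw.1 _ (x τ).2.2 i).1)).trans ?_
  -- The two signs of an expert bound the sum from both sides.
  · rw [abs_le]
    have h1 := hreg (i, j, true)
    have h2 := hreg (i, j, false)
    simp only [gain, if_true, one_mul] at h1
    simp only [gain, Bool.false_eq_true, if_false, neg_one_mul, Finset.sum_neg_distrib] at h2
    exact ⟨by linarith, h1⟩
  · rw [add_zero, rate, ← hlcast, ← hΛ, mul_div_assoc]
    refine le_of_eq (congrArg _ ?_)
    set l : ℝ := (((t : ℕ) - (s : ℕ) : ℕ) : ℝ)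
    rw [show Λ * l = Λ / l * l ^ 2 by field_simp, Real.sqrt_mul' _ (sq_nonneg l),
      Real.sqrt_sq hl.le, mul_div_cancel_right₀ _ hl.ne']

/-- Here `C` is a single point and every forecast is exact; the case is separate because the
learning rates divide by the diameter. -/
theorem exists_isAdaptivelyCalibrated_of_diam_eq_zero {m k : ℕ} {C : Set (Fin m → ℝ)}
    (hne : C.Nonempty) (hC : IsCompact C) {w : Fin k → (Fin m → ℝ) → ℝ} (hw : IsBinning C w)
    (c : ℝ) (hD : Metric.diam C = 0) :
    ∃ σ : ForecastingProcedure C, IsAdaptivelyCalibrated σ w 0 (rate c (Metric.diam C) k m) := by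
  obtain ⟨p₀, hp₀⟩ := hne
  refine ⟨fun _ _ => PMF.pure ⟨p₀, hp₀⟩, fun δ hδ hδ1 adv T => ?_⟩
  refine le_of_le_of_eq (b := 1) (by simpa using hδ.le) (Eq.symm ?_)
  rw [PMF.toOuterMeasure_apply_eq_one_iff]
  refine fun x _ s t hst i => ?_
  rw [rate, hD, mul_zero, zero_mul, zero_add]
  refine (calErr_le hst le_rfl (fun j => ?_)
    (Finset.sum_nonneg fun τ _ => (hw.1 _ (x τ).2.2 i).1)).trans_eq (zero_div _)
  rw [Finset.sum_eq_zero, abs_zero]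
  intro τ _
  have h := abs_sub_apply_le_diam hC (x τ).2.2 (x τ).1.2 j
  rw [hD, abs_nonpos_iff] at h
  rw [h, mul_zero]

theorem exists_isAdaptivelyCalibrated {m k : ℕ} {C : Set (Fin m → ℝ)} (hne : C.Nonempty)
    (hC : IsCompact C) (hconv : Convex ℝ C) {w : Fin k → (Fin m → ℝ) → ℝ} (hw : IsBinning C w) :
    ∃ σ : ForecastingProcedure C, IsAdaptivelyCalibrated σ w 0 (rate 16 (Metric.diam C) k m) := by
  rcases (Metric.diam_nonneg (s := C)).eq_or_lt with hD | hD
  · exact exists_isAdaptivelyCalibrated_of_diam_eq_zero hne hC hw 16 hD.symm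
  · have hk : 0 < k := by
      obtain ⟨p, hp⟩ := hne
      rcases Nat.eq_zero_or_pos k with rfl | h
      · simpa using hw.2 p hp
      · exact h
    have hm : 0 < m := by
      rcases Nat.eq_zero_or_pos m with rfl | h
      · rw [Metric.diam_subsingleton (Set.subsingleton_of_subsingleton)] at hD
        exact absurd hD (lt_irrefl _)
      · exact h
    exact exists_isAdaptivelyCalibrated_of_diam_pos hk hm hne hC hconv hw hD

theorem IsAdaptivelyCalibrated.mono {m k : ℕ} {C : Set (Fin m → ℝ)} {σ : ForecastingProcedure C}
    {w : Fin k → (Fin m → ℝ) → ℝ} {ε ε' : ℝ} {r : ℝ → ℕ → ℕ → ℝ} (hε : ε ≤ ε')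
    (h : IsAdaptivelyCalibrated σ w ε r) : IsAdaptivelyCalibrated σ w ε' r :=
  fun δ hδ hδ1 adv T => (h δ hδ hδ1 adv T).trans
    (MeasureTheory.measure_mono fun _ hx s t hst i => (hx s t hst i).trans (by gcongr))

end AdaptiveCalibration

theorem theorem3 :
    ∃ c : ℝ, 0 < c ∧
      ∀ (m k : ℕ) (C : Set (Fin m → ℝ)) (w : Fin k → (Fin m → ℝ) → ℝ),
        C.Nonempty → IsCompact C → Convex ℝ C → AdaptiveCalibration.IsBinning C w →
        (∀ ε : ℝ, 0 < ε → ∃ σ : AdaptiveCalibration.ForecastingProcedure C,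
          AdaptiveCalibration.IsAdaptivelyCalibrated σ w ε
            (AdaptiveCalibration.rate c (Metric.diam C) k m)) ∧
        ((∀ i, ContinuousOn (w i) C) → ∃ σ : AdaptiveCalibration.ForecastingProcedure C,
          AdaptiveCalibration.IsAdaptivelyCalibrated σ w 0
            (AdaptiveCalibration.rate c (Metric.diam C) k m)) := by
  refine ⟨16, by norm_num, fun m k C w hne hC hconv hw => ?_⟩
  obtain ⟨σ, hσ⟩ := AdaptiveCalibration.exists_isAdaptivelyCalibrated hne hC hconv hw
  exact ⟨fun ε hε => ⟨σ, hσ.mono hε.le⟩, fun _ => ⟨σ, hσ⟩⟩
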